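/- Let $\mathbb F_q$ be the field with $q$ elements, let $n\ge 1$, and let $G$ be a simple graph with vertices $v_1,\dots,v_{n+1}$ such that $v_{n+1}$ is an apex, i.e. adjacent to every other vertex. Let $$Q_G(x)=\sum_T\prod_{e\in T}x_e,$$ where $T$ ranges over the (edge sets of) spanning trees of $G$ and the variables $x_e$ are indexed by the edges of $G$, and let $g_G(q)$ be the number of ways of substituting elements of $\mathbb F_q$ for the variables $x_e$ so that $Q_G(x)\ne 0$. For an $n\times n$ matrix $H$ over $\mathbb F_q$ put $\langle a,b\rangle_H=aHb^t$ for row vectors $a,b\in\mathbb F_q^n$, let $\Omega_H=\{A\in \mathrm{GL}(n,q): AHA^t=H\}$, and let $b_{G,H}$ be the number of ordered bases $(u_1,\dots,u_n)$ of $\mathbb F_q^n$ such that $\langle u_i,u_j\rangle_H=0$ for all $i\neq j$ in $\{1,\dots,n\}$ for which $v_iv_j$ is not an edge of $G$. Write $b_G^+(q)=b_{G,I}$ and $\Omega^+(n,q)=\Omega(n,q)=\Omega_I$, where $I$ is the identity matrix. If $q$ is odd, write $b_G^-(q)=b_{G,D}$ and $\Omega^-(n,q)=\Omega_D$, where $D=\mathrm{diag}(\alpha,1,\dots,1)$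 for a fixed, arbitrarily chosen nonsquare $\alpha\in\mathbb F_q$. If $q$ and $n$ are both even, write $b_G^-(q)=b_{G,E}$ and $\Omega^-(n,q)=\Omega_E$, where $E$ is the direct sum of $n/2$ copies of $\begin{pmatrix}0&1\\1&0\end{pmatrix}$. Theorem. If $q$ is odd, or if $q$ and $n$ are both even, then $$g_G(q)=\frac{b_G^+(q)}{\#\Omega^+(n,q)}+\frac{b_G^-(q)}{\#\Omega^-(n,q)}.$$ If $q$ is even and $n$ is odd, then $$g_G(q)=\frac{b_G^+(q)}{\#\Omega(n,q)}.$$ -/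

import Mathlib

open scoped Matrix

/-- `v` is an apex of `G`: it is joined by an edge to every other vertex. -/
def SimpleGraph.IsApex {V : Type*} (G : SimpleGraph V) (v : V) : Prop :=
  ∀ w, w ≠ v → G.Adj v w

/-- A set `T` of edges of `G` is (the edge set of) a spanning tree of `G`: the graph on all the
vertices of `G` whose edges are those of `T` is a tree. -/
def SimpleGraph.IsSpanningTree {V : Type*} (G : SimpleGraph V) (T : Finset G.edgeSet) : Prop :=
  (SimpleGraph.fromEdgeSet {e : Sym2 V | ∃ h : e ∈ G.edgeSet, (⟨e, h⟩ : G.edgeSet) ∈ T}).IsTree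

open Classical in
/-- The polynomial `Q_G = ∑_T ∏_{e ∈ T} x_e`, summed over the spanning trees `T` of `G`, in the
variables `x_e` indexed by the edges of `G`. -/
noncomputable def SimpleGraph.treePoly {V : Type*} [Fintype V] (G : SimpleGraph V) :
    MvPolynomial G.edgeSet ℤ :=
  ∑ T : Finset G.edgeSet with G.IsSpanningTree T, ∏ e ∈ T, MvPolynomial.X e

/-- `g_G(q)` for `q = #F`: the number of ways of substituting elements of `F` for the variables
`x_e` such that `Q_G(x) ≠ 0`. -/
noncomputable def SimpleGraph.treeCount {V : Type*} [Fintype V] (G : SimpleGraph V)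
    (F : Type*) [Field F] : ℕ :=
  Nat.card {x : G.edgeSet → F // MvPolynomial.aeval x G.treePoly ≠ 0}

/-- The scalar product `a H bᵗ` on `F ^ n` given by the matrix `H`. -/
def scalarProd {F : Type*} [Field F] {n : ℕ} (H : Matrix (Fin n) (Fin n) F)
    (a b : Fin n → F) : F :=
  a ⬝ᵥ (H *ᵥ b)

/-- The matrix `D = diag(α, 1, …, 1)`. -/
def matD {F : Type*} [Field F] (n : ℕ) (α : F) : Matrix (Fin n) (Fin n) F :=
  Matrix.diagonal fun i => if (i : ℕ) = 0 then α else 1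

/-- For even `n`, the direct sum `E` of `n / 2` copies of `!![0, 1; 1, 0]`: with indices starting
at `0`, the entry is `1` exactly at the positions `(2k, 2k+1)` and `(2k+1, 2k)`. -/
def matE (F : Type*) [Field F] (n : ℕ) : Matrix (Fin n) (Fin n) F :=
  Matrix.of fun i j => if i ≠ j ∧ (i : ℕ) / 2 = (j : ℕ) / 2 then 1 else 0

/-- The group of all `A ∈ GL(n, F)` with `A H Aᵗ = H`. -/
def omegaGroup {F : Type*} [Field F] {n : ℕ} (H : Matrix (Fin n) (Fin n) F) :
    Subgroup (GL (Fin n) F) where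
  carrier := {A | (A : Matrix (Fin n) (Fin n) F) * H * (A : Matrix (Fin n) (Fin n) F)ᵀ = H}
  one_mem' := by simp
  mul_mem' := by
    intro A B hA hB
    simp only [Set.mem_ofPred_eq, Units.val_mul, Matrix.transpose_mul] at *
    calc (A : Matrix (Fin n) (Fin n) F) * B * H
          * ((B : Matrix (Fin n) (Fin n) F)ᵀ * (A : Matrix (Fin n) (Fin n) F)ᵀ)
        = A * (B * H * (B : Matrix (Fin n) (Fin n) F)ᵀ) * (A : Matrix (Fin n) (Fin n) F)ᵀ := by
          simp only [Matrix.mul_assoc]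
      _ = H := by rw [hB, hA]
  inv_mem' := by
    intro A hA
    simp only [Set.mem_ofPred_eq] at *
    have h1 : ((A⁻¹ : GL (Fin n) F) : Matrix (Fin n) (Fin n) F) * A = 1 := by
      rw [← Units.val_mul, inv_mul_cancel, Units.val_one]
    have h2 : (A : Matrix (Fin n) (Fin n) F)ᵀ
        * (((A⁻¹ : GL (Fin n) F) : Matrix (Fin n) (Fin n) F))ᵀ = 1 := by
      rw [← Matrix.transpose_mul, h1, Matrix.transpose_one]
    conv_lhs => rw [← hA]
    calc ((A⁻¹ : GL (Fin n) F) : Matrix (Fin n) (Fin n) F)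
          * (A * H * (A : Matrix (Fin n) (Fin n) F)ᵀ)
          * (((A⁻¹ : GL (Fin n) F) : Matrix (Fin n) (Fin n) F))ᵀ
        = (((A⁻¹ : GL (Fin n) F) : Matrix (Fin n) (Fin n) F) * A) * H
          * ((A : Matrix (Fin n) (Fin n) F)ᵀ
            * (((A⁻¹ : GL (Fin n) F) : Matrix (Fin n) (Fin n) F))ᵀ) := by
          simp only [Matrix.mul_assoc]
      _ = H := by rw [h1, h2, Matrix.one_mul, Matrix.mul_one]

/-- For a graph on `v_1, …, v_{n+1}` (here `0, …, n`), the number of ordered bases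
`(u_1, …, u_n)` of `F ^ n` with `⟨u_i, u_j⟩ = 0`, for the scalar product given by `H`, whenever
`i ≠ j` and `v_i v_j` is not an edge. -/
noncomputable def orthBasisCount {F : Type*} [Field F] {n : ℕ} (G : SimpleGraph (Fin (n + 1)))
    (H : Matrix (Fin n) (Fin n) F) : ℕ :=
  Nat.card {u : Module.Basis (Fin n) F (Fin n → F) //
    ∀ i j : Fin n, i ≠ j → ¬ G.Adj i.castSucc j.castSucc → scalarProd H (u i) (u j) = 0}

/-! By the matrix-tree theorem (`SimpleGraph.aeval_treePoly`), the value of `Q_G` is the determinant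
of the weighted Laplacian with the row and column of the apex deleted. The edges to the apex make
the diagonal of that matrix arbitrary, so substitutions correspond to symmetric matrices vanishing
at the non-edges, and `g_G` counts the invertible ones (`SimpleGraph.IsApex.treeCount_eq`).

If a basis is written as the rows of `A`, its Gram matrix is `A H Aᵗ`, and the orthogonality
condition says that this matrix vanishes at the non-edges. Each matrix congruent to `H` is the Gram
matrix of exactly `#Ω_H` bases, by orbit-stabilizer (`orthBasisCount_eq_mul`). Hence `b_{G,H} /
#Ω_H` counts the supported matrices in the congruence class of `H`.

It remains to classify invertible symmetric matrices up to congruence. For odd `q` the classes are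
those of `I` and `D`, told apart by the determinant modulo squares; for even `q` they are those of
`I` and, only when `n` is even, the alternating class of `E`. -/

/-! ### The matrix-tree theorem. -/

/-- A parent function `f`, assigning a vertex of `Fin (n + 1)` to every vertex other than the last,
is rooted if iterating it always leads to the last vertex. -/
def IsRootedFun {n : ℕ} (f : Fin n → Fin (n + 1)) : Prop :=
  ∃ d : Fin (n + 1) → ℕ, ∀ i, d (f i) < d i.castSucc

/-- The reduced Laplacian matrix of the functional digraph `i ↦ f i`. -/
def parentMatrix (R : Type*) [CommRing R] {n : ℕ} (f : Fin n → Fin (n + 1)) :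
    Matrix (Fin n) (Fin n) R :=
  Matrix.of fun i j => (if i = j then 1 else 0) - (if f i = j.castSucc then 1 else 0)

/-- Parents have smaller depth `d`, so the matrix is block triangular for the depth. No vertex is
the parent of one of equal depth, so the diagonal blocks are identities. -/
theorem det_parentMatrix_of_isRootedFun (R : Type*) [CommRing R] {n : ℕ}
    {f : Fin n → Fin (n + 1)} (hf : IsRootedFun f) : (parentMatrix R f).det = 1 := by
  obtain ⟨d, hd⟩ := hf
  have ht : (parentMatrix R f).BlockTriangular fun i => OrderDual.toDual (d i.castSucc) := by
    intro i j hij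
    have hij : d i.castSucc < d j.castSucc := hij
    have h1 : i ≠ j := by rintro rfl; exact lt_irrefl _ hij
    have h2 : f i ≠ j.castSucc := by
      intro h
      have := hd i
      rw [h] at this
      omega
    simp [parentMatrix, h1, h2]
  rw [ht.det]
  refine Finset.prod_eq_one fun a _ => ?_
  suffices h : (parentMatrix R f).toSquareBlock (fun i => OrderDual.toDual (d i.castSucc)) a = 1 by
    rw [h, Matrix.det_one]
  ext ⟨i, hi⟩ ⟨j, hj⟩
  have h2 : f i ≠ j.castSucc := by
    intro h
    have h3 := hd i
    rw [h] at h3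
    have : d i.castSucc = d j.castSucc := OrderDual.toDual.injective (hi.trans hj.symm)
    omega
  simp [Matrix.toSquareBlock_def, parentMatrix, h2, Matrix.one_apply]

/-- The vertices from which iteration never reaches the root form a nonempty set, containing a
vertex exactly when it contains its parent. The indicator of this set is a kernel vector. -/
theorem det_parentMatrix_of_not_isRootedFun (R : Type*) [CommRing R] [IsDomain R] {n : ℕ}
    {f : Fin n → Fin (n + 1)} (hf : ¬ IsRootedFun f) : (parentMatrix R f).det = 0 := by
  classical
  let g : Fin (n + 1) → Fin (n + 1) := Fin.lastCases (Fin.last n) f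
  have hg0 : g (Fin.last n) = Fin.last n := by simp [g]
  have hg : ∀ i, g (Fin.castSucc i) = f i := by simp [g]
  let U : Fin (n + 1) → Prop := fun v => ∀ k, g^[k] v ≠ Fin.last n
  have hU : ∀ v, v ≠ Fin.last n → (U (g v) ↔ U v) := by
    intro v hv
    refine ⟨fun h k => ?_, fun h k => h (k + 1)⟩
    cases k with
    | zero => simpa using hv
    | succ k => exact h k
  have hU0 : ¬ U (Fin.last n) := fun h => h 0 rfl
  have hex : ∃ i : Fin n, U i.castSucc := by
    by_contra! hne
    have hall : ∀ v, ∃ k, g^[k] v = Fin.last n := by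
      intro v
      induction v using Fin.lastCases with
      | last => exact ⟨0, rfl⟩
      | cast i => simpa [U] using hne i
    -- If every vertex reached the root, the number of iterations needed would serve as `d`.
    refine hf ⟨fun v => Nat.find (hall v), fun i => ?_⟩
    have h1 := Nat.find_spec (hall i.castSucc)
    rcases h : Nat.find (hall i.castSucc) with _ | k
    · rw [h] at h1
      exact absurd h1 (Fin.castSucc_lt_last i).ne
    · rw [h, Function.iterate_succ_apply, hg] at h1
      have := Nat.find_min' (hall (f i)) h1
      simpa only [h] using Nat.lt_succ_of_le this
  obtain ⟨i₀, hi₀⟩ := hex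
  apply Matrix.exists_mulVec_eq_zero_iff.mp
  refine ⟨fun j => if U j.castSucc then 1 else 0, fun h => ?_, ?_⟩
  · simpa [hi₀] using congrFun h i₀
  · ext i
    have key : ∀ v : Fin (n + 1),
        (∑ j : Fin n, if v = j.castSucc then (if U j.castSucc then (1 : R) else 0) else 0)
          = if U v then 1 else 0 := by
      intro v
      induction v using Fin.lastCases with
      | last => simp [hU0, fun j : Fin n => (Fin.castSucc_lt_last j).ne']
      | cast k => simp
    have h1 := key (f i)
    have h2 := hU i.castSucc (Fin.castSucc_lt_last i).ne
    rw [hg] at h2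
    simp only [h2] at h1
    simp only [Matrix.mulVec, dotProduct, parentMatrix, Matrix.of_apply, sub_mul, ite_mul, one_mul,
      zero_mul, Finset.sum_sub_distrib, h1]
    simp

/-- The reduced Laplacian matrix (the last row and column being deleted) for the weights `w`. -/
def reducedLaplacian {R : Type*} [CommRing R] {n : ℕ} (w : Fin (n + 1) → Fin (n + 1) → R) :
    Matrix (Fin n) (Fin n) R :=
  Matrix.of fun i j => (if i = j then ∑ k, w i.castSucc k else 0) - w i.castSucc j.castSucc

-- Row `i` is `∑ k, w i k • (e_i - e_k)`, where `e_k` is zero for the deleted vertex. Multilinearity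
-- of the determinant in the rows expands it over all functions `f`, and only the rooted ones
-- survive.
open Classical in
theorem det_reducedLaplacian {R : Type*} [CommRing R] [IsDomain R] {n : ℕ}
    (w : Fin (n + 1) → Fin (n + 1) → R) :
    (reducedLaplacian w).det =
      ∑ f : Fin n → Fin (n + 1) with IsRootedFun f, ∏ i, w i.castSucc (f i) := by
  have h1 : reducedLaplacian w = fun i => ∑ k, (w i.castSucc k •
      fun j : Fin n => (if i = j then (1 : R) else 0) - (if k = j.castSucc then 1 else 0)) := by
    ext i j
    simp only [reducedLaplacian, Matrix.of_apply, Finset.sum_apply, Pi.smul_apply, smul_eq_mul,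
      mul_sub, Finset.sum_sub_distrib]
    congr 1 <;> simp
  have h2 := (Matrix.detRowAlternating (n := Fin n) (R := R)).toMultilinearMap.map_sum
    (fun (i : Fin n) (k : Fin (n + 1)) => (w i.castSucc k •
      fun j : Fin n => (if i = j then (1 : R) else 0) - (if k = j.castSucc then 1 else 0)))
  rw [h1]
  refine h2.trans ?_
  rw [Finset.sum_filter]
  refine Finset.sum_congr rfl fun f _ => ?_
  have h3 := (Matrix.detRowAlternating (n := Fin n) (R := R)).toMultilinearMap.map_smul_univ
    (fun i => w i.castSucc (f i)) (parentMatrix R f)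
  refine h3.trans ?_
  change _ • (parentMatrix R f).det = _
  split_ifs with hf
  · rw [det_parentMatrix_of_isRootedFun R hf, smul_eq_mul, mul_one]
  · rw [det_parentMatrix_of_not_isRootedFun R hf, smul_zero]

/-- The graph joining every vertex other than the last to its parent. -/
def parentGraph {n : ℕ} (f : Fin n → Fin (n + 1)) : SimpleGraph (Fin (n + 1)) :=
  SimpleGraph.fromEdgeSet (Set.range fun i : Fin n => s(i.castSucc, f i))

namespace IsRootedFun

variable {n : ℕ} {f g : Fin n → Fin (n + 1)}

theorem ne_castSucc (hf : IsRootedFun f) (i : Fin n) : i.castSucc ≠ f i := by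
  obtain ⟨d, hd⟩ := hf
  intro h
  have := hd i
  rw [← h] at this
  exact lt_irrefl _ this

theorem not_swap (hf : IsRootedFun f) {i j : Fin n} (hi : f i = j.castSucc)
    (hj : f j = i.castSucc) : False := by
  obtain ⟨d, hd⟩ := hf
  have h1 := hd i
  have h2 := hd j
  rw [hi] at h1
  rw [hj] at h2
  omega

theorem sym2_injective (hf : IsRootedFun f) :
    Function.Injective fun i : Fin n => s(i.castSucc, f i) := by
  intro i j hij
  rcases Sym2.eq_iff.mp hij with ⟨h, -⟩ | ⟨h1, h2⟩
  · exact Fin.castSucc_injective n h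
  · exact (hf.not_swap h2 h1.symm).elim

/-- Induction on depth: if `g` traversed the edge from `i` to `f i` in the opposite direction, then
`g`, and by induction `f`, would send `f i` back to `i`, a 2-cycle. -/
theorem eq_of_range_subset (hf : IsRootedFun f)
    (h : ∀ i, ∃ j : Fin n, s(j.castSucc, g j) = s(i.castSucc, f i)) : f = g := by
  obtain ⟨d, hd⟩ := id hf
  have key : ∀ m, ∀ i : Fin n, d i.castSucc = m → f i = g i := by
    intro m
    induction m using Nat.strong_induction_on with
    | _ m ih =>
      rintro i rfl
      obtain ⟨j, hj⟩ := h i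
      rcases Sym2.eq_iff.mp hj with ⟨h1, h2⟩ | ⟨h1, h2⟩
      · rw [← h2, Fin.castSucc_injective n h1]
      · have h3 := hd i
        rw [← h1] at h3
        exact (hf.not_swap h1.symm ((ih _ h3 j rfl).trans h2)).elim
  exact funext fun i => key _ i rfl

theorem isTree_parentGraph (hf : IsRootedFun f) : (parentGraph f).IsTree := by
  rw [SimpleGraph.isTree_iff_connected_and_card]
  refine ⟨?_, ?_⟩
  · obtain ⟨d, hd⟩ := id hf
    have key : ∀ m, ∀ v, d v = m → (parentGraph f).Reachable v (Fin.last n) := by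
      intro m
      induction m using Nat.strong_induction_on with
      | _ m ih =>
        rintro v rfl
        induction v using Fin.lastCases with
        | last => rfl
        | cast i =>
          have hadj : (parentGraph f).Adj i.castSucc (f i) := by
            rw [parentGraph, SimpleGraph.fromEdgeSet_adj]
            exact ⟨⟨i, rfl⟩, hf.ne_castSucc i⟩
          exact hadj.reachable.trans (ih _ (hd i) _ rfl)
    exact (SimpleGraph.connected_iff _).mpr
      ⟨fun u v => (key _ u rfl).trans (key _ v rfl).symm, inferInstance⟩
  · have h1 : (parentGraph f).edgeSet = Set.range fun i : Fin n => s(i.castSucc, f i) := by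
      rw [parentGraph, SimpleGraph.edgeSet_fromEdgeSet]
      refine sdiff_eq_left.mpr (Set.disjoint_left.mpr ?_)
      rintro _ ⟨i, rfl⟩ hi
      exact hf.ne_castSucc i (by simpa using hi)
    rw [h1, Nat.card_range_of_injective hf.sym2_injective]
    simp

end IsRootedFun

/-- A connected graph has a rooted parent function along its edges. -/
theorem SimpleGraph.Connected.exists_isRootedFun {n : ℕ} {G : SimpleGraph (Fin (n + 1))}
    (hG : G.Connected) :
    ∃ f : Fin n → Fin (n + 1), IsRootedFun f ∧ ∀ i, G.Adj i.castSucc (f i) := by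
  have key : ∀ i : Fin n, ∃ v, G.Adj i.castSucc v ∧
      G.dist v (Fin.last n) < G.dist i.castSucc (Fin.last n) := by
    intro i
    -- The parent is the next vertex on a shortest walk to the root.
    obtain ⟨p, hp⟩ := hG.exists_walk_length_eq_dist i.castSucc (Fin.last n)
    have hne := (Fin.castSucc_lt_last i).ne
    generalize i.castSucc = u, Fin.last n = r at p hp hne
    cases p with
    | nil => exact absurd rfl hne
    | cons h p =>
      refine ⟨_, h, ?_⟩
      rw [← hp, SimpleGraph.Walk.length_cons]
      exact Nat.lt_succ_of_le (SimpleGraph.dist_le p)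
  choose f hf using key
  exact ⟨f, ⟨fun v => G.dist v (Fin.last n), fun i => (hf i).2⟩, fun i => (hf i).1⟩

/-- The parent graph of a rooted function lying in a tree is the whole tree. -/
theorem SimpleGraph.IsTree.edgeSet_eq_range {n : ℕ} {G : SimpleGraph (Fin (n + 1))}
    (hG : G.IsTree) {f : Fin n → Fin (n + 1)} (hf : IsRootedFun f)
    (hadj : ∀ i, G.Adj i.castSucc (f i)) :
    G.edgeSet = Set.range fun i : Fin n => s(i.castSucc, f i) := by
  symm
  apply Set.eq_of_subset_of_ncard_le _ _ (Set.toFinite _)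
  · rintro _ ⟨i, rfl⟩
    exact hadj i
  · have h := (SimpleGraph.isTree_iff_connected_and_card.mp hG).2
    rw [← Nat.card_coe_set_eq, ← Nat.card_coe_set_eq,
      Nat.card_range_of_injective hf.sym2_injective]
    simp at h ⊢
    omega

open Classical in
/-- The symmetric weight function on pairs of vertices given by weights on the edges. -/
noncomputable def SimpleGraph.edgeWeight {V R : Type*} [Zero R] (G : SimpleGraph V)
    (x : G.edgeSet → R) (u v : V) : R :=
  if h : G.Adj u v then x ⟨s(u, v), G.mem_edgeSet.mpr h⟩ else 0

/-- The matrix-tree theorem. -/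
theorem SimpleGraph.aeval_treePoly {R : Type*} [CommRing R] [IsDomain R] {n : ℕ}
    (G : SimpleGraph (Fin (n + 1))) (x : G.edgeSet → R) :
    MvPolynomial.aeval x G.treePoly = (reducedLaplacian (G.edgeWeight x)).det := by
  classical
  rw [det_reducedLaplacian, SimpleGraph.treePoly, map_sum]
  simp only [map_prod, MvPolynomial.aeval_X]
  have h1 : ∑ f : Fin n → Fin (n + 1) with IsRootedFun f,
      ∏ i, G.edgeWeight x i.castSucc (f i) =
      ∑ f : Fin n → Fin (n + 1) with IsRootedFun f ∧ ∀ i, G.Adj i.castSucc (f i),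
      ∏ i, G.edgeWeight x i.castSucc (f i) := by
    rw [← Finset.filter_filter]
    refine (Finset.sum_filter_of_ne fun f _ hne i => ?_).symm
    by_contra hi
    exact hne (Finset.prod_eq_zero (Finset.mem_univ i) (by simp [edgeWeight, hi]))
  rw [h1]
  symm
  have hset : ∀ (f : Fin n → Fin (n + 1)) (hadj : ∀ i, G.Adj i.castSucc (f i)),
      {e : Sym2 (Fin (n + 1)) | ∃ h : e ∈ G.edgeSet, (⟨e, h⟩ : G.edgeSet) ∈
        Finset.univ.image fun i : Fin n => (⟨s(i.castSucc, f i), G.mem_edgeSet.mpr (hadj i)⟩ : G.edgeSet)} =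
      Set.range fun i : Fin n => s(i.castSucc, f i) := by
    intro f hadj
    ext e
    simp only [Finset.mem_image, Finset.mem_univ, true_and, Subtype.mk.injEq, Set.mem_ofPred_eq,
      Set.mem_range]
    exact ⟨fun ⟨_, h⟩ => h, fun ⟨i, h⟩ => ⟨h ▸ hadj i, i, h⟩⟩
  -- Orienting the edges of a spanning tree towards the root makes it the edge set of exactly one
  -- rooted function.
  refine Finset.sum_bij (fun f hf => Finset.univ.image fun i : Fin n =>
    (⟨s(i.castSucc, f i), G.mem_edgeSet.mpr ((Finset.mem_filter.mp hf).2.2 i)⟩ : G.edgeSet)) ?_ ?_ ?_ ?_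
  · intro f hf
    rw [Finset.mem_filter] at hf ⊢
    refine ⟨Finset.mem_univ _, ?_⟩
    rw [SimpleGraph.IsSpanningTree, hset f hf.2.2]
    exact hf.2.1.isTree_parentGraph
  · intro f hf g hg hfg
    rw [Finset.mem_filter] at hf hg
    refine hf.2.1.eq_of_range_subset fun i => ?_
    have : (⟨s(i.castSucc, f i), G.mem_edgeSet.mpr (hf.2.2 i)⟩ : G.edgeSet) ∈ Finset.univ.image fun i : Fin n =>
        (⟨s(i.castSucc, g i), G.mem_edgeSet.mpr (hg.2.2 i)⟩ : G.edgeSet) := by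
      rw [← hfg]
      exact Finset.mem_image_of_mem _ (Finset.mem_univ i)
    obtain ⟨j, -, hj⟩ := Finset.mem_image.mp this
    exact ⟨j, congrArg Subtype.val hj⟩
  · intro T hT
    have hT := (Finset.mem_filter.mp hT).2
    obtain ⟨f, hf, hadj⟩ := SimpleGraph.Connected.exists_isRootedFun hT.connected
    have hmem : ∀ e : Sym2 (Fin (n + 1)), (∃ i : Fin n, s(i.castSucc, f i) = e) ↔
        ∃ h : e ∈ G.edgeSet, (⟨e, h⟩ : G.edgeSet) ∈ T := by
      intro e
      have h2 := Set.ext_iff.mp (SimpleGraph.IsTree.edgeSet_eq_range hT hf hadj) e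
      rw [SimpleGraph.edgeSet_fromEdgeSet] at h2
      rw [Set.mem_range] at h2
      rw [← h2]
      refine ⟨fun h => h.1, fun h => ⟨h, ?_⟩⟩
      exact G.not_isDiag_of_mem_edgeSet h.1
    have hG : ∀ i, G.Adj i.castSucc (f i) := fun i => ((hmem _).mp ⟨i, rfl⟩).1
    refine ⟨f, Finset.mem_filter.mpr ⟨Finset.mem_univ _, hf, hG⟩, ?_⟩
    ext ⟨e, he⟩
    simp only [Finset.mem_image, Finset.mem_univ, true_and, Subtype.mk.injEq]
    rw [hmem e]
    exact ⟨fun h => h.2, fun h => ⟨he, h⟩⟩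
  · intro f hf
    have hf := (Finset.mem_filter.mp hf).2
    rw [Finset.prod_image fun i _ j _ hij => hf.1.sym2_injective (congrArg Subtype.val hij)]
    exact Finset.prod_congr rfl fun i _ => by simp [edgeWeight, hf.2 i]

/-! ### Edge weights as symmetric matrices. -/

/-- The matrix `M`, indexed by the vertices other than the last, has entries that vanish off
the diagonal and off the edges of `G`. -/
def SimpleGraph.IsSupported {F : Type*} [Zero F] {n : ℕ} (G : SimpleGraph (Fin (n + 1)))
    (M : Matrix (Fin n) (Fin n) F) : Prop :=
  ∀ i j : Fin n, i ≠ j → ¬ G.Adj i.castSucc j.castSucc → M i j = 0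

theorem SimpleGraph.edgeWeight_comm {V R : Type*} [Zero R] (G : SimpleGraph V)
    (x : G.edgeSet → R) (u v : V) : G.edgeWeight x u v = G.edgeWeight x v u := by
  by_cases h : G.Adj u v
  · simp only [edgeWeight, h, h.symm, Sym2.eq_swap (a := u)]
  · simp [edgeWeight, h, G.adj_comm v u]

theorem SimpleGraph.edgeWeight_injective {V R : Type*} [Zero R] (G : SimpleGraph V)
    {x y : G.edgeSet → R} (h : ∀ u v, G.edgeWeight x u v = G.edgeWeight y u v) : x = y := by
  ext ⟨e, he⟩
  induction e using Sym2.inductionOn with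
  | _ u v => simpa [edgeWeight, G.mem_edgeSet.mp he] using h u v

theorem SimpleGraph.exists_edgeWeight_eq {V R : Type*} [Zero R] (G : SimpleGraph V)
    {w : V → V → R} (hw : ∀ u v, w u v = w v u) (h0 : ∀ u v, ¬ G.Adj u v → w u v = 0) :
    ∃ x : G.edgeSet → R, G.edgeWeight x = w := by
  refine ⟨fun e => Sym2.lift ⟨w, hw⟩ e.1, ?_⟩
  ext u v
  by_cases h : G.Adj u v
  · simp [edgeWeight, h]
  · simp [edgeWeight, h, h0]

/-- All other terms of the row sum cancel. The weights at the apex, and with them the diagonal, are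
thus recovered from the row sums. -/
theorem sum_reducedLaplacian {R : Type*} [CommRing R] {n : ℕ}
    (w : Fin (n + 1) → Fin (n + 1) → R) (i : Fin n) :
    ∑ j, reducedLaplacian w i j = w i.castSucc (Fin.last n) := by
  simp [reducedLaplacian, Finset.sum_sub_distrib, Fin.sum_univ_castSucc]

theorem reducedLaplacian_of_ne {R : Type*} [CommRing R] {n : ℕ}
    (w : Fin (n + 1) → Fin (n + 1) → R) {i j : Fin n} (h : i ≠ j) :
    reducedLaplacian w i j = - w i.castSucc j.castSucc := by
  simp [reducedLaplacian, h]

/-- If the last vertex is an apex, taking the reduced Laplacian identifies weights on the edges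
with symmetric matrices supported on the graph, and the weights with nonzero value of the tree
polynomial correspond to the invertible matrices. -/
theorem SimpleGraph.IsApex.treeCount_eq {F : Type*} [Field F] {n : ℕ}
    {G : SimpleGraph (Fin (n + 1))} (hG : G.IsApex (Fin.last n)) :
    G.treeCount F =
      Nat.card {M : Matrix (Fin n) (Fin n) F // G.IsSupported M ∧ M.IsSymm ∧ M.det ≠ 0} := by
  refine Nat.card_congr (Equiv.ofBijective
    (fun x => ⟨reducedLaplacian (G.edgeWeight x.1), ?_, ?_, ?_⟩) ⟨?_, ?_⟩)
  · intro i j hij hadj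
    simp [reducedLaplacian_of_ne _ hij, edgeWeight, hadj]
  · ext i j
    by_cases hij : i = j
    · rw [hij, Matrix.transpose_apply]
    · rw [Matrix.transpose_apply, reducedLaplacian_of_ne _ hij,
        reducedLaplacian_of_ne _ (Ne.symm hij), G.edgeWeight_comm]
  · rw [← G.aeval_treePoly]
    exact x.2
  · intro x y hxy
    have hxy : reducedLaplacian (G.edgeWeight x.1) = reducedLaplacian (G.edgeWeight y.1) :=
      congrArg Subtype.val hxy
    refine Subtype.ext (G.edgeWeight_injective ?_)
    have hlast : ∀ i : Fin n, G.edgeWeight x.1 i.castSucc (Fin.last n) =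
        G.edgeWeight y.1 i.castSucc (Fin.last n) := fun i => by
      rw [← sum_reducedLaplacian (G.edgeWeight x.1), hxy, sum_reducedLaplacian]
    have hloop : ∀ (z : G.edgeSet → F) u, G.edgeWeight z u u = 0 := fun z u => by
      simp [edgeWeight]
    intro u v
    by_cases huv : u = v
    · rw [huv, hloop, hloop]
    induction u using Fin.lastCases with
    | last =>
      induction v using Fin.lastCases with
      | last => exact absurd rfl huv
      | cast j => rw [G.edgeWeight_comm, hlast, G.edgeWeight_comm]
    | cast i =>
      induction v using Fin.lastCases with
      | last => exact hlast i
      | cast j =>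
        have hij : i ≠ j := fun h => huv (by rw [h])
        have := congrFun (congrFun hxy i) j
        rwa [reducedLaplacian_of_ne _ hij, reducedLaplacian_of_ne _ hij, neg_inj] at this
  · rintro ⟨M, hsupp, hsymm, hdet⟩
    -- Edges to the apex get the row sums of `M`; the others get the negated entries.
    let w : Fin (n + 1) → Fin (n + 1) → F :=
      Fin.lastCases (Fin.lastCases 0 fun j => ∑ k, M j k)
        fun i => Fin.lastCases (∑ k, M i k) fun j => if i = j then 0 else - M i j
    have hw : ∀ u v, w u v = w v u := by
      intro u v
      induction u using Fin.lastCases <;> induction v using Fin.lastCases <;>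
        simp [w, eq_comm, hsymm.apply]
    have hw0 : ∀ u v, ¬ G.Adj u v → w u v = 0 := by
      intro u v huv
      induction u using Fin.lastCases with
      | last =>
        induction v using Fin.lastCases with
        | last => simp [w]
        | cast j => exact absurd (hG _ (Fin.castSucc_lt_last j).ne) huv
      | cast i =>
        induction v using Fin.lastCases with
        | last => exact absurd (hG _ (Fin.castSucc_lt_last i).ne).symm huv
        | cast j =>
          simp only [w, Fin.lastCases_castSucc]
          split_ifs with h
          · rfl
          · rw [hsupp i j h huv, neg_zero]
    obtain ⟨x, hx⟩ := G.exists_edgeWeight_eq hw hw0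
    have hM : reducedLaplacian (G.edgeWeight x) = M := by
      rw [hx]
      have hne : ∀ i j, i ≠ j → reducedLaplacian w i j = M i j := by
        intro i j hij
        simp [reducedLaplacian_of_ne _ hij, w, hij]
      ext i j
      by_cases hij : i = j
      · subst hij
        have h := sum_reducedLaplacian w i
        have h' : w i.castSucc (Fin.last n) = ∑ k, M i k := by simp [w]
        -- The row sums agree and so do the off-diagonal entries, hence also the diagonal ones.
        rw [h', ← Finset.add_sum_erase _ _ (Finset.mem_univ i),
          ← Finset.add_sum_erase (a := i) _ (fun k => M i k) (Finset.mem_univ i),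
          Finset.sum_congr rfl fun k hk => hne i k (Finset.ne_of_mem_erase hk).symm] at h
        exact add_right_cancel h
      · exact hne i j hij
    refine ⟨⟨x, ?_⟩, Subtype.ext hM⟩
    rwa [G.aeval_treePoly, hM]

/-! ### Counting bases by their Gram matrices. -/

theorem orthBasisCount_eq_card {F : Type*} [Field F] {n : ℕ} (G : SimpleGraph (Fin (n + 1)))
    (H : Matrix (Fin n) (Fin n) F) :
    orthBasisCount G H = Nat.card {A : GL (Fin n) F // G.IsSupported (A.1 * H * A.1ᵀ)} := by
  have hprod : ∀ (A : Matrix (Fin n) (Fin n) F) i j,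
      (A * H * Aᵀ) i j = scalarProd H (A i) (A j) := by
    intro A i j
    rw [Matrix.mul_assoc, Matrix.mul_apply, scalarProd]
    rfl
  have hunit : ∀ u : Module.Basis (Fin n) F (Fin n → F), (Matrix.of fun i => u i).det ≠ 0 := by
    intro u
    refine ((Matrix.isUnit_iff_isUnit_det _).mp ?_).ne_zero
    exact Matrix.linearIndependent_rows_iff_isUnit.mp u.linearIndependent
  refine Nat.card_congr (Equiv.ofBijective (fun u => ⟨Matrix.GeneralLinearGroup.mkOfDetNeZero
    (Matrix.of fun i => u.1 i) (hunit u.1), ?_⟩) ⟨?_, ?_⟩)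
  · intro i j hij hadj
    rw [hprod]
    exact u.2 i j hij hadj
  · intro u v huv
    refine Subtype.ext (Module.Basis.eq_of_apply_eq fun i => ?_)
    exact congrFun (congrArg (fun A => A.1.1) huv) i
  · rintro ⟨A, hA⟩
    have hli : LinearIndependent F A.1.row :=
      Matrix.linearIndependent_rows_iff_isUnit.mpr A.isUnit
    refine ⟨⟨basisOfLinearIndependentOfCardEqFinrank' _ hli (by simp), fun i j hij hadj => ?_⟩, ?_⟩
    · have := hA i j hij hadj
      rw [hprod] at this
      simpa using! this
    · refine Subtype.ext (Units.ext ?_)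
      ext i j
      simp [Matrix.GeneralLinearGroup.mkOfDetNeZero]

/-- Two matrices are congruent. -/
def Matrix.IsCongruent {F : Type*} [Field F] {n : ℕ} (H M : Matrix (Fin n) (Fin n) F) : Prop :=
  ∃ A : GL (Fin n) F, A.1 * H * A.1ᵀ = M

/-- Orbit-stabilizer: the fibre of `A ↦ A H Aᵗ` over `M` is the coset `A₀ M * Ω_H`. -/
theorem orthBasisCount_eq_mul {F : Type*} [Field F] {n : ℕ} (G : SimpleGraph (Fin (n + 1)))
    (H : Matrix (Fin n) (Fin n) F) :
    orthBasisCount G H =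
      Nat.card {M : Matrix (Fin n) (Fin n) F // G.IsSupported M ∧ H.IsCongruent M} *
        Nat.card (omegaGroup H) := by
  rw [orthBasisCount_eq_card, ← Nat.card_prod]
  symm
  let A₀ : ∀ M : {M : Matrix (Fin n) (Fin n) F // G.IsSupported M ∧ H.IsCongruent M},
    GL (Fin n) F := fun M => M.2.2.choose
  have hA₀ : ∀ M, (A₀ M).1 * H * (A₀ M).1ᵀ = M.1 := fun M => M.2.2.choose_spec
  have hmul : ∀ A B : GL (Fin n) F,
      (A * B).1 * H * (A * B).1ᵀ = A.1 * (B.1 * H * B.1ᵀ) * A.1ᵀ := by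
    intro A B
    simp only [Units.val_mul, Matrix.transpose_mul, Matrix.mul_assoc]
  have hval : ∀ M (B : omegaGroup H), (A₀ M * B.1).1 * H * (A₀ M * B.1).1ᵀ = M.1 := by
    intro M B
    have hB : B.1.1 * H * B.1.1ᵀ = H := B.2
    rw [hmul, hB, hA₀]
  refine Nat.card_congr (Equiv.ofBijective (fun p => ⟨A₀ p.1 * p.2.1, ?_⟩) ⟨?_, ?_⟩)
  · rw [hval]
    exact p.1.2.1
  · rintro ⟨M, B⟩ ⟨M', B'⟩ h
    have h : A₀ M * B.1 = A₀ M' * B'.1 := congrArg Subtype.val h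
    have hM : M = M' := Subtype.ext (by rw [← hval M B, h, hval])
    subst hM
    rw [Subtype.ext (mul_left_cancel h)]
  · rintro ⟨A, hA⟩
    let M : {M : Matrix (Fin n) (Fin n) F // G.IsSupported M ∧ H.IsCongruent M} :=
      ⟨A.1 * H * A.1ᵀ, hA, A, rfl⟩
    refine ⟨⟨M, ⟨(A₀ M)⁻¹ * A, ?_⟩⟩, Subtype.ext (mul_inv_cancel_left _ _)⟩
    change ((A₀ M)⁻¹ * A).1 * H * ((A₀ M)⁻¹ * A).1ᵀ = H
    rw [hmul, show A.1 * H * A.1ᵀ = (A₀ M).1 * H * (A₀ M).1ᵀ from (hA₀ M).symm, ← hmul,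
      inv_mul_cancel]
    simp

theorem orthBasisCount_div_card {F : Type*} [Field F] [Finite F] {n : ℕ}
    (G : SimpleGraph (Fin (n + 1))) (H : Matrix (Fin n) (Fin n) F) :
    (orthBasisCount G H : ℚ) / (Nat.card (omegaGroup H) : ℚ) =
      Nat.card {M : Matrix (Fin n) (Fin n) F // G.IsSupported M ∧ H.IsCongruent M} := by
  have : Finite (GL (Fin n) F) := inferInstance
  have h0 : (Nat.card (omegaGroup H) : ℚ) ≠ 0 := by
    exact_mod_cast Nat.card_pos.ne'
  rw [orthBasisCount_eq_mul, Nat.cast_mul, mul_div_cancel_right₀ _ h0]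

/-- Reduces the two-term formulas to the classification of invertible symmetric matrices up to
congruence. -/
theorem SimpleGraph.IsApex.treeCount_eq_add {F : Type*} [Field F] [Finite F] {n : ℕ}
    {G : SimpleGraph (Fin (n + 1))} (hG : G.IsApex (Fin.last n))
    {H K : Matrix (Fin n) (Fin n) F}
    (h : ∀ M : Matrix (Fin n) (Fin n) F,
      M.IsSymm ∧ M.det ≠ 0 ↔ H.IsCongruent M ∨ K.IsCongruent M)
    (hHK : ∀ M, H.IsCongruent M → ¬ K.IsCongruent M) :
    (G.treeCount F : ℚ) = (orthBasisCount G H : ℚ) / (Nat.card (omegaGroup H) : ℚ) +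
      (orthBasisCount G K : ℚ) / (Nat.card (omegaGroup K) : ℚ) := by
  classical
  rw [orthBasisCount_div_card, orthBasisCount_div_card, hG.treeCount_eq, ← Nat.cast_add,
    ← Nat.card_sum]
  congr 1
  have hd : Disjoint (fun M => G.IsSupported M ∧ H.IsCongruent M)
      (fun M => G.IsSupported M ∧ K.IsCongruent M) := by
    rw [Pi.disjoint_iff]
    intro M
    rw [Prop.disjoint_iff]
    exact fun hM => hHK M hM.1.2 hM.2.2
  refine Nat.card_congr ((Equiv.subtypeEquivRight fun M => ?_).trans (subtypeOrEquiv _ _ hd))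
  rw [h, and_or_left]

theorem SimpleGraph.IsApex.treeCount_eq_of_forall {F : Type*} [Field F] [Finite F] {n : ℕ}
    {G : SimpleGraph (Fin (n + 1))} (hG : G.IsApex (Fin.last n))
    {H : Matrix (Fin n) (Fin n) F}
    (h : ∀ M : Matrix (Fin n) (Fin n) F, M.IsSymm ∧ M.det ≠ 0 ↔ H.IsCongruent M) :
    (G.treeCount F : ℚ) = (orthBasisCount G H : ℚ) / (Nat.card (omegaGroup H) : ℚ) := by
  rw [orthBasisCount_div_card, hG.treeCount_eq]
  simp only [h]

/-! ### Normal forms of nondegenerate symmetric bilinear forms. -/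

namespace LinearMap.BilinForm

variable {F V : Type*} [Field F] [AddCommGroup V] [Module F V]

/-- Appending a unit vector orthogonal to a family with Gram matrix `diag(d, 1, …, 1)`. -/
theorem gram_snoc_matD {B : LinearMap.BilinForm F V} (hs : B.IsSymm) {m : ℕ} {d : F}
    {w : Fin (m + 1) → V} (hw : ∀ i j, B (w i) (w j) = matD (m + 1) d i j) {x : V}
    (hx : B x x = 1) (hxw : ∀ i, B x (w i) = 0) (i j : Fin (m + 2)) :
    B (Fin.snoc (α := fun _ => V) w x i) (Fin.snoc (α := fun _ => V) w x j) =
      matD (m + 2) d i j := by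
  have hwx : ∀ i, B (w i) x = 0 := fun i => by rw [← hxw i]; exact hs.eq _ _
  induction i using Fin.lastCases with
  | last =>
    induction j using Fin.lastCases with
    | last => simp [hx, matD]
    | cast j => simp [hxw, matD, Matrix.diagonal_apply_ne _ (Fin.castSucc_lt_last j).ne']
  | cast i =>
    induction j using Fin.lastCases with
    | last => simp [hwx, matD]
    | cast j => simp [hw, matD, Matrix.diagonal_apply]

theorem finrank_orthogonal_span_singleton [FiniteDimensional F V] {B : LinearMap.BilinForm F V}
    (hB : B.Nondegenerate) {x : V} (hx : B x x ≠ 0) {m : ℕ} (hm : Module.finrank F V = m + 1) :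
    Module.finrank F (B.orthogonal (F ∙ x)) = m := by
  have hx0 : x ≠ 0 := by
    rintro rfl
    simp at hx
  rw [finrank_orthogonal hB, finrank_span_singleton hx0, hm, Nat.add_sub_cancel]

/-- Splitting off a unit vector in the construction of a family with Gram matrix
`diag(d, 1, …, 1)`. -/
theorem exists_gram_matD_of_orthogonal {B : LinearMap.BilinForm F V} (hs : B.IsSymm) {m : ℕ}
    {x : V} (hx : B x x = 1) {d : F}
    (h : ∃ w : Fin (m + 1) → B.orthogonal (F ∙ x), ∀ i j,
      B.restrict (B.orthogonal (F ∙ x)) (w i) (w j) = matD (m + 1) d i j) :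
    ∃ v : Fin (m + 2) → V, ∀ i j, B (v i) (v j) = matD (m + 2) d i j := by
  obtain ⟨w, hw⟩ := h
  refine ⟨_, gram_snoc_matD hs (w := fun i => (w i : V)) (fun i j => hw i j) hx fun i => ?_⟩
  exact (w i).2 x (Submodule.mem_span_singleton_self x)

section OddCharacteristic

/-- Take orthogonal anisotropic vectors `y`, `z`. Over a finite field of odd order the equation `B y
y * s² + B z z * t² = 1` is solvable, and `s • y + t • z` is a unit vector. -/
theorem exists_apply_self_eq_one [Fintype F] (hF : Fintype.card F % 2 = 1)
    [FiniteDimensional F V] {B : LinearMap.BilinForm F V} (hs : B.IsSymm) (hB : B.Nondegenerate)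
    {m : ℕ} (hm : Module.finrank F V = m + 2) : ∃ x, B x x = 1 := by
  have h2 : (2 : F) ≠ 0 := Ring.two_ne_zero fun h => by
    have := FiniteField.even_card_iff_char_two.mp h
    omega
  let : Invertible (2 : F) := invertibleOfNonzero h2
  have : Nontrivial V := Module.nontrivial_of_finrank_pos (R := F) (by omega)
  obtain ⟨y, hy⟩ := exists_bilinForm_self_ne_zero hB.ne_zero (isSymm_iff.mp hs)
  have hW := finrank_orthogonal_span_singleton hB hy hm
  have : Nontrivial (B.orthogonal (F ∙ y)) :=
    Module.nontrivial_of_finrank_pos (R := F) (by omega)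
  have hBW := B.restrict_nondegenerate_orthogonal_spanSingleton hB hs.isRefl hy
  obtain ⟨z, hz⟩ := exists_bilinForm_self_ne_zero hBW.ne_zero (isSymm_iff.mp (hs.restrict _))
  have hyz : B y z = 0 := z.2 y (Submodule.mem_span_singleton_self y)
  have hzy : B z y = 0 := by rw [← hyz]; exact hs.eq _ _
  have hz : B z z ≠ 0 := hz
  obtain ⟨s, t, hst⟩ := FiniteField.exists_root_sum_quadratic
    (f := Polynomial.C (B y y) * Polynomial.X ^ 2)
    (g := Polynomial.C (B z z) * Polynomial.X ^ 2 - Polynomial.C 1)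
    (Polynomial.degree_C_mul_X_pow 2 hy)
    (by
      rw [Polynomial.degree_sub_C, Polynomial.degree_C_mul_X_pow 2 hz]
      · rfl
      · rw [Polynomial.degree_C_mul_X_pow 2 hz]
        decide) hF
  refine ⟨s • y + t • (z : V), ?_⟩
  simp only [Polynomial.eval_mul, Polynomial.eval_C, Polynomial.eval_pow, Polynomial.eval_X,
    Polynomial.eval_sub] at hst
  simp only [map_add, map_smul, LinearMap.add_apply, LinearMap.smul_apply, smul_eq_mul, hyz, hzy]
  linear_combination hst

/-- A nondegenerate symmetric bilinear form over a finite field of odd order has Gram matrix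
`diag(d, 1, …, 1)` in a suitable basis. -/
theorem exists_gram_eq_matD [Fintype F] (hF : Fintype.card F % 2 = 1) (m : ℕ) :
    ∀ {V : Type*} [AddCommGroup V] [Module F V] [FiniteDimensional F V]
      {B : LinearMap.BilinForm F V}, B.IsSymm → B.Nondegenerate → Module.finrank F V = m + 1 →
      ∃ d : F, d ≠ 0 ∧ ∃ v : Fin (m + 1) → V, ∀ i j, B (v i) (v j) = matD (m + 1) d i j := by
  induction m with
  | zero =>
    intro V _ _ _ B hs hB hm
    have h2 : (2 : F) ≠ 0 := Ring.two_ne_zero fun h => by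
      have := FiniteField.even_card_iff_char_two.mp h
      omega
    let : Invertible (2 : F) := invertibleOfNonzero h2
    have : Nontrivial V := Module.nontrivial_of_finrank_pos (R := F) (by omega)
    obtain ⟨y, hy⟩ := exists_bilinForm_self_ne_zero hB.ne_zero (isSymm_iff.mp hs)
    exact ⟨B y y, hy, fun _ => y, fun i j => by
      simp [matD, Fin.fin_one_eq_zero i, Fin.fin_one_eq_zero j]⟩
  | succ m ih =>
    intro V _ _ _ B hs hB hm
    obtain ⟨x, hx⟩ := exists_apply_self_eq_one hF hs hB hm
    have hx0 : B x x ≠ 0 := hx ▸ one_ne_zero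
    obtain ⟨d, hd, h⟩ := ih (hs.restrict (B.orthogonal (F ∙ x)))
      (B.restrict_nondegenerate_orthogonal_spanSingleton hB hs.isRefl hx0)
      (finrank_orthogonal_span_singleton hB hx0 hm)
    exact ⟨d, hd, exists_gram_matD_of_orthogonal hs hx h⟩

end OddCharacteristic

section CharTwo

theorem exists_apply_eq_one {B : LinearMap.BilinForm F V} (hB : B.Nondegenerate) {e : V}
    (he : e ≠ 0) : ∃ f, B e f = 1 := by
  by_contra! h
  refine he (hB.1 e fun f => ?_)
  by_contra hf
  apply h ((B e f)⁻¹ • f)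
  simp [hf]

theorem exists_apply_self_eq_one_of_isSquare (hF : ∀ a : F, IsSquare a)
    {B : LinearMap.BilinForm F V} (h : ∃ y, B y y ≠ 0) : ∃ x, B x x = 1 := by
  obtain ⟨y, hy⟩ := h
  obtain ⟨r, hr⟩ := hF (B y y)
  have hr0 : r ≠ 0 := by
    rintro rfl
    simp [hr] at hy
  refine ⟨r⁻¹ • y, ?_⟩
  simp only [map_smul, LinearMap.smul_apply, smul_eq_mul, hr]
  field_simp

/-- Over a perfect field of characteristic two, a nondegenerate symmetric bilinear form that is
not alternating admits a unit vector whose orthogonal complement is not alternating. -/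
theorem exists_unit_not_alternating [CharP F 2] (hF : ∀ a : F, IsSquare a)
    [FiniteDimensional F V] {B : LinearMap.BilinForm F V} (hs : B.IsSymm) (hB : B.Nondegenerate)
    {m : ℕ} (hm : Module.finrank F V = m + 2) (hne : ∃ y, B y y ≠ 0) :
    ∃ x, B x x = 1 ∧ ∃ y, B x y = 0 ∧ B y y ≠ 0 := by
  obtain ⟨x, hx⟩ := exists_apply_self_eq_one_of_isSquare hF hne
  by_cases hW : ∃ y, B x y = 0 ∧ B y y ≠ 0
  · exact ⟨x, hx, hW⟩
  push Not at hW
  have hx0 : B x x ≠ 0 := hx ▸ one_ne_zero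
  have hfr := finrank_orthogonal_span_singleton hB hx0 hm
  have : Nontrivial (B.orthogonal (F ∙ x)) :=
    Module.nontrivial_of_finrank_pos (R := F) (by omega)
  obtain ⟨e, he⟩ := exists_ne (0 : B.orthogonal (F ∙ x))
  obtain ⟨f, hef⟩ := exists_apply_eq_one
    (B.restrict_nondegenerate_orthogonal_spanSingleton hB hs.isRefl hx0) he
  have hef : B e f = 1 := hef
  have hxe : B x e = 0 := e.2 x (Submodule.mem_span_singleton_self x)
  have hxf : B x f = 0 := f.2 x (Submodule.mem_span_singleton_self x)
  have hex : B e x = 0 := by rw [← hxe]; exact hs.eq _ _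
  have hfx : B f x = 0 := by rw [← hxf]; exact hs.eq _ _
  -- Here the complement of `x` is alternating, so `x + e` and `x + f` both have square 1, and `B (x
  -- + e) (x + f) = 1 + 1 = 0`.
  refine ⟨x + e, ?_, x + f, ?_, ?_⟩
  · simp [hx, hxe, hex, hW _ hxe]
  · simp [hx, hxf, hex, hef, CharTwo.add_self_eq_zero]
  · simp [hx, hxf, hfx, hW _ hxf]

/-- Unit vectors are split off one at a time. `exists_unit_not_alternating` chooses them so that the
complement still satisfies the hypothesis of the induction. -/
theorem exists_gram_eq_one [CharP F 2] (hF : ∀ a : F, IsSquare a) (m : ℕ) :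
    ∀ {V : Type*} [AddCommGroup V] [Module F V] [FiniteDimensional F V]
      {B : LinearMap.BilinForm F V}, B.IsSymm → B.Nondegenerate → Module.finrank F V = m + 1 →
      (∃ y, B y y ≠ 0) →
      ∃ v : Fin (m + 1) → V, ∀ i j, B (v i) (v j) = matD (m + 1) 1 i j := by
  induction m with
  | zero =>
    intro V _ _ _ B hs hB hm hne
    obtain ⟨x, hx⟩ := exists_apply_self_eq_one_of_isSquare hF hne
    exact ⟨fun _ => x, fun i j => by
      simp [matD, Fin.fin_one_eq_zero i, Fin.fin_one_eq_zero j, hx]⟩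
  | succ m ih =>
    intro V _ _ _ B hs hB hm hne
    obtain ⟨x, hx, y, hxy, hy⟩ := exists_unit_not_alternating hF hs hB hm hne
    have hx0 : B x x ≠ 0 := hx ▸ one_ne_zero
    have hyW : y ∈ B.orthogonal (F ∙ x) := by
      intro z hz
      obtain ⟨c, rfl⟩ := Submodule.mem_span_singleton.mp hz
      simp [hxy]
    exact exists_gram_matD_of_orthogonal hs hx <| ih (hs.restrict (B.orthogonal (F ∙ x)))
      (B.restrict_nondegenerate_orthogonal_spanSingleton hB hs.isRefl hx0)
      (finrank_orthogonal_span_singleton hB hx0 hm) ⟨⟨y, hyW⟩, hy⟩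

/-- Appending a hyperbolic pair orthogonal to a family with Gram matrix `E`. -/
theorem gram_snoc_matE {B : LinearMap.BilinForm F V} (hs : B.IsSymm) (ha : ∀ x, B x x = 0)
    {m : ℕ} (hm : Even m) {w : Fin m → V} (hw : ∀ i j, B (w i) (w j) = matE F m i j) {e f : V}
    (hef : B e f = 1) (hew : ∀ i, B e (w i) = 0) (hfw : ∀ i, B f (w i) = 0)
    (i j : Fin (m + 2)) :
    B (Fin.snoc (α := fun _ => V) (Fin.snoc (α := fun _ => V) w e) f i)
      (Fin.snoc (α := fun _ => V) (Fin.snoc (α := fun _ => V) w e) f j) =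
      matE F (m + 2) i j := by
  have hwe : ∀ i, B (w i) e = 0 := fun i => by rw [← hew i]; exact hs.eq _ _
  have hwf : ∀ i, B (w i) f = 0 := fun i => by rw [← hfw i]; exact hs.eq _ _
  have hfe : B f e = 1 := by rw [← hef]; exact hs.eq _ _
  obtain ⟨k, rfl⟩ := hm
  -- Evenness makes the two appended positions a pair of `E`, separate from all earlier pairs.
  have h1 : (k + k + 1) / 2 = (k + k) / 2 := by omega
  have h2 : ∀ i : Fin (k + k), (i : ℕ) / 2 ≠ (k + k) / 2 := fun i => by omega
  induction i using Fin.lastCases with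
  | last =>
    induction j using Fin.lastCases with
    | last => simp [ha, matE]
    | cast j =>
      induction j using Fin.lastCases with
      | last => simp [hfe, matE, Fin.ext_iff, h1]
      | cast j => simp [hfw, matE, h1, (h2 j).symm]
  | cast i =>
    induction i using Fin.lastCases with
    | last =>
      induction j using Fin.lastCases with
      | last => simp [hef, matE, Fin.ext_iff, h1]
      | cast j =>
        induction j using Fin.lastCases with
        | last => simp [ha, matE]
        | cast j => simp [hew, matE, (h2 j).symm]
    | cast i =>
      induction j using Fin.lastCases with
      | last => simp [hwf, matE, h1, h2 i]
      | cast j =>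
        induction j using Fin.lastCases with
        | last => simp [hwe, matE, h2 i]
        | cast j => simp [hw, matE]

/-- Hyperbolic planes are split off until nothing is left, which also forces the dimension to be
even. -/
theorem exists_gram_eq_matE (m : ℕ) :
    ∀ {V : Type*} [AddCommGroup V] [Module F V] [FiniteDimensional F V]
      {B : LinearMap.BilinForm F V}, B.IsSymm → B.Nondegenerate → (∀ x, B x x = 0) →
      Module.finrank F V = m →
      Even m ∧ ∃ v : Fin m → V, ∀ i j, B (v i) (v j) = matE F m i j := by
  induction m using Nat.strong_induction_on with
  | _ m ih =>
    intro V _ _ _ B hs hB ha hm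
    rcases Nat.eq_zero_or_pos m with rfl | hpos
    · exact ⟨Even.zero, Fin.elim0, fun i => i.elim0⟩
    have : Nontrivial V := Module.nontrivial_of_finrank_pos (R := F) (by omega)
    obtain ⟨e, he⟩ := exists_ne (0 : V)
    obtain ⟨f, hef⟩ := exists_apply_eq_one hB he
    have hfe : B f e = 1 := by rw [← hef]; exact hs.eq _ _
    let S : Submodule F V := Submodule.span F {e, f}
    have heS : e ∈ S := Submodule.subset_span (by simp)
    have hfS : f ∈ S := Submodule.subset_span (by simp)
    have hli : LinearIndependent F ![e, f] := by
      rw [LinearIndependent.pair_iff]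
      intro s t hst
      have h1 := congrArg (B e) hst
      have h2 := congrArg (B f) hst
      simp [ha, hef, hfe] at h1 h2
      exact ⟨h2, h1⟩
    have hS : Module.finrank F S = 2 := by
      have := finrank_span_eq_card hli
      rwa [Matrix.range_cons_cons_empty, Fintype.card_fin] at this
    have hle : 2 ≤ m := by
      rw [← hS, ← hm]
      exact Submodule.finrank_le S
    obtain ⟨k, rfl⟩ := Nat.exists_eq_add_of_le' hle
    have hW : Module.finrank F (B.orthogonal S) = k := by
      rw [finrank_orthogonal hB, hS, hm, Nat.add_sub_cancel]
    have hdisj : Disjoint S (B.orthogonal S) := by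
      rw [Submodule.disjoint_def]
      intro x hx hx'
      obtain ⟨s, t, rfl⟩ := Submodule.mem_span_pair.mp hx
      have h1 : B e (s • e + t • f) = 0 := hx' e heS
      have h2 : B f (s • e + t • f) = 0 := hx' f hfS
      simp [ha, hef, hfe] at h1 h2
      simp [h1, h2]
    have hBW : (B.restrict (B.orthogonal S)).Nondegenerate := by
      refine B.nondegenerate_restrict_of_disjoint_orthogonal hs.isRefl ?_
      rw [orthogonal_orthogonal hB hs.isRefl]
      exact hdisj.symm
    obtain ⟨hev, w, hw⟩ := ih k (by omega) (hs.restrict (B.orthogonal S)) hBW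
      (fun x => ha x) hW
    refine ⟨hev.add even_two, _, gram_snoc_matE hs ha hev (w := fun i => (w i : V))
      (fun i j => hw i j) hef (fun i => (w i).2 e heS) (fun i => (w i).2 f hfS)⟩

end CharTwo

end LinearMap.BilinForm

/-! ### Congruence classes of invertible symmetric matrices. -/

namespace Matrix

variable {F : Type*} [Field F] {n : ℕ}

theorem IsCongruent.symm {H M : Matrix (Fin n) (Fin n) F} (h : H.IsCongruent M) :
    M.IsCongruent H := by
  obtain ⟨A, rfl⟩ := h
  refine ⟨A⁻¹, ?_⟩
  have h1 : (A⁻¹).1 * A.1 = 1 := by rw [← Units.val_mul, inv_mul_cancel, Units.val_one]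
  have h2 : A.1ᵀ * (A⁻¹).1ᵀ = 1 := by rw [← transpose_mul, h1, transpose_one]
  calc (A⁻¹).1 * (A.1 * H * A.1ᵀ) * (A⁻¹).1ᵀ
      = ((A⁻¹).1 * A.1) * H * (A.1ᵀ * (A⁻¹).1ᵀ) := by simp only [Matrix.mul_assoc]
    _ = H := by rw [h1, h2, Matrix.one_mul, Matrix.mul_one]

theorem IsCongruent.trans {H M N : Matrix (Fin n) (Fin n) F} (h : H.IsCongruent M)
    (h' : M.IsCongruent N) : H.IsCongruent N := by
  obtain ⟨A, rfl⟩ := h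
  obtain ⟨B, rfl⟩ := h'
  refine ⟨B * A, ?_⟩
  simp only [Units.val_mul, transpose_mul, Matrix.mul_assoc]

theorem IsCongruent.isSymm {H M : Matrix (Fin n) (Fin n) F} (h : H.IsCongruent M)
    (hH : H.IsSymm) : M.IsSymm := by
  obtain ⟨A, rfl⟩ := h
  rw [IsSymm, transpose_mul, transpose_mul, transpose_transpose, hH.eq, Matrix.mul_assoc]

theorem IsCongruent.exists_det_eq {H M : Matrix (Fin n) (Fin n) F} (h : H.IsCongruent M) :
    ∃ c : F, c ≠ 0 ∧ M.det = c * c * H.det := by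
  obtain ⟨A, rfl⟩ := h
  refine ⟨A.1.det, ((isUnit_iff_isUnit_det _).mp A.isUnit).ne_zero, ?_⟩
  rw [det_mul, det_mul, det_transpose]
  ring

theorem IsCongruent.det_ne_zero {H M : Matrix (Fin n) (Fin n) F} (h : H.IsCongruent M)
    (hH : H.det ≠ 0) : M.det ≠ 0 := by
  obtain ⟨c, hc, h⟩ := h.exists_det_eq
  rw [h]
  exact mul_ne_zero (mul_ne_zero hc hc) hH

/-- A family of vectors whose Gram matrix with respect to `M` is the invertible matrix `H`
exhibits a congruence between `H` and `M`. -/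
theorem isCongruent_of_gram {H M : Matrix (Fin n) (Fin n) F} (hH : H.det ≠ 0)
    {v : Fin n → Fin n → F} (hv : ∀ i j, M.toBilin' (v i) (v j) = H i j) : H.IsCongruent M := by
  have h1 : of v * M * (of v)ᵀ = H := by
    ext i j
    rw [← hv i j, toBilin'_apply', Matrix.mul_assoc, mul_apply]
    rfl
  have h2 : (of v).det ≠ 0 := by
    intro h
    apply hH
    rw [← h1, det_mul, det_mul, h, zero_mul, zero_mul]
  exact IsCongruent.symm ⟨GeneralLinearGroup.mkOfDetNeZero (of v) h2, h1⟩

theorem isSymm_toBilin' {M : Matrix (Fin n) (Fin n) F} (hM : M.IsSymm) :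
    LinearMap.BilinForm.IsSymm M.toBilin' := by
  refine ⟨fun x y => ?_⟩
  rw [toBilin'_apply', toBilin'_apply', dotProduct_mulVec, dotProduct_comm, ← mulVec_transpose,
    hM.eq]

theorem matD_one : matD n (1 : F) = 1 := by
  simp [matD]

theorem isSymm_matD (α : F) : (matD n α).IsSymm := isSymm_diagonal _

theorem det_matD (α : F) : (matD (n + 1) α).det = α := by
  simp [matD]

theorem isCongruent_matD_mul_self {α c : F} (hc : c ≠ 0) :
    (matD n α).IsCongruent (matD n (c * c * α)) := by
  have h : (matD n c).det ≠ 0 := by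
    rw [matD, det_diagonal, Finset.prod_ne_zero_iff]
    intro i _
    split_ifs
    · exact hc
    · exact one_ne_zero
  refine ⟨GeneralLinearGroup.mkOfDetNeZero (matD n c) h, ?_⟩
  change matD n c * matD n α * (matD n c)ᵀ = _
  rw [(isSymm_matD c).eq, matD, matD, matD, diagonal_mul_diagonal, diagonal_mul_diagonal]
  congr 1
  ext i
  split_ifs <;> ring

theorem isSymm_matE : (matE F n).IsSymm := by
  ext i j
  simp [matE, eq_comm]

/-- Each index has a partner, and the partner's row has its only nonzero entry at that index. A
kernel vector therefore vanishes everywhere. -/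
theorem det_matE_ne_zero (hn : Even n) : (matE F n).det ≠ 0 := by
  intro h
  obtain ⟨x, hx, h⟩ := exists_mulVec_eq_zero_iff.mpr h
  refine hx (funext fun j => ?_)
  obtain ⟨i, hij, hi⟩ : ∃ i : Fin n, i ≠ j ∧ (i : ℕ) / 2 = (j : ℕ) / 2 := by
    obtain ⟨k, rfl⟩ := hn
    have := j.2
    rcases Nat.even_or_odd' (j : ℕ) with ⟨l, hl | hl⟩
    · exact ⟨⟨2 * l + 1, by omega⟩, by simp [Fin.ext_iff, hl], by simp only []; omega⟩
    · exact ⟨⟨2 * l, by omega⟩, by simp [Fin.ext_iff, hl], by simp only []; omega⟩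
  have h := congrFun h i
  rw [mulVec, dotProduct, Finset.sum_eq_single j] at h
  · simpa [matE, hij, hi] using h
  · intro k _ hk
    have : ¬ (i ≠ k ∧ (i : ℕ) / 2 = (k : ℕ) / 2) := by
      simp only [ne_eq, Fin.ext_iff] at hij hk ⊢
      omega
    simp [matE, this]
  · simp

/-- The terms at `(i, j)` and `(j, i)` cancel in characteristic two, and the diagonal terms are
zero. -/
theorem toBilin'_matE_self [CharP F 2] (x : Fin n → F) : (matE F n).toBilin' x x = 0 := by
  rw [toBilin'_apply, ← Finset.sum_product']
  refine Finset.sum_involution (fun p _ => p.swap) ?_ ?_ ?_ ?_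
  · rintro ⟨i, j⟩ -
    have : matE F n j i = matE F n i j := isSymm_matE.apply i j
    simp only [Prod.swap_prod_mk, this, mul_right_comm _ _ (x i), mul_comm (x j) (x i)]
    rw [show x i * x j * matE F n i j = x i * matE F n i j * x j by ring]
    exact CharTwo.add_self_eq_zero _
  · rintro ⟨i, j⟩ - hne heq
    obtain rfl : j = i := congrArg Prod.fst heq
    simp [matE] at hne
  · simp
  · simp

/-- Over a field of characteristic two, `E` is not congruent to a matrix with a nonzero diagonal
entry. -/
theorem IsCongruent.diag_eq_zero [CharP F 2] {M : Matrix (Fin n) (Fin n) F}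
    (h : (matE F n).IsCongruent M) (i : Fin n) : M i i = 0 := by
  obtain ⟨A, rfl⟩ := h
  rw [← toBilin'_matE_self (A.1 i), toBilin'_apply', Matrix.mul_assoc, mul_apply]
  rfl

theorem isSymm_and_det_ne_zero_iff_of_odd [Fintype F] (hF : Odd (Fintype.card F)) {α : F}
    (hα : ¬ IsSquare α) (M : Matrix (Fin (n + 1)) (Fin (n + 1)) F) :
    M.IsSymm ∧ M.det ≠ 0 ↔
      (1 : Matrix (Fin (n + 1)) (Fin (n + 1)) F).IsCongruent M ∨
        (matD (n + 1) α).IsCongruent M := by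
  have hα0 : α ≠ 0 := by
    rintro rfl
    exact hα (IsSquare.zero)
  refine ⟨fun ⟨hs, hd⟩ => ?_, ?_⟩
  · obtain ⟨d, hd0, v, hv⟩ := LinearMap.BilinForm.exists_gram_eq_matD (Nat.odd_iff.mp hF) n
      (isSymm_toBilin' hs) (LinearMap.BilinForm.nondegenerate_toBilin'_of_det_ne_zero' M hd)
      (by simp)
    have hcong : (matD (n + 1) d).IsCongruent M :=
      isCongruent_of_gram (by rwa [det_matD]) hv
    by_cases hsq : IsSquare d
    · left
      obtain ⟨c, rfl⟩ := hsq
      have h := isCongruent_matD_mul_self (n := n + 1) (α := (1 : F)) (left_ne_zero_of_mul hd0)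
      rw [mul_one, matD_one] at h
      exact h.trans hcong
    · right
      -- The quotient of two nonsquares is a square, by multiplicativity of the quadratic character.
      obtain ⟨c, hc⟩ : IsSquare (d / α) := by
        classical
        have h2 : ringChar F ≠ 2 := fun h => by
          have := FiniteField.even_card_iff_char_two.mp h
          exact absurd (Nat.odd_iff.mp hF) (by omega)
        rw [← quadraticChar_one_iff_isSquare (div_ne_zero hd0 hα0), div_eq_mul_inv, map_mul,
          quadraticChar_neg_one_iff_not_isSquare.mpr hsq,
          quadraticChar_neg_one_iff_not_isSquare.mpr (by rwa [isSquare_inv])]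
        rfl
      have hd' : d = c * c * α := by
        rw [← hc, div_mul_cancel₀ _ hα0]
      have hc0 : c ≠ 0 := by
        rintro rfl
        simp [hd'] at hd0
      exact (isCongruent_matD_mul_self hc0).trans (hd' ▸ hcong)
  · rintro (h | h)
    · exact ⟨h.isSymm isSymm_one, h.det_ne_zero (by simp)⟩
    · exact ⟨h.isSymm (isSymm_matD α), h.det_ne_zero (by rwa [det_matD])⟩

/-- Congruence changes the determinant by a nonzero square, and the determinants here are `1` and
the nonsquare `α`. -/
theorem IsCongruent.not_matD {α : F} (hα : ¬ IsSquare α)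
    {M : Matrix (Fin (n + 1)) (Fin (n + 1)) F}
    (h : (1 : Matrix (Fin (n + 1)) (Fin (n + 1)) F).IsCongruent M) :
    ¬ (matD (n + 1) α).IsCongruent M := by
  intro h'
  obtain ⟨c, -, hc⟩ := (h.trans h'.symm).exists_det_eq
  rw [det_matD, det_one, mul_one] at hc
  exact hα ⟨c, hc⟩

/-- The two cases are whether or not the form takes a nonzero value `B y y`. -/
theorem isCongruent_one_or_matE_of_charTwo [CharP F 2] (hF : ∀ a : F, IsSquare a)
    {M : Matrix (Fin (n + 1)) (Fin (n + 1)) F} (hs : M.IsSymm) (hd : M.det ≠ 0) :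
    (1 : Matrix (Fin (n + 1)) (Fin (n + 1)) F).IsCongruent M ∨
      Even (n + 1) ∧ (matE F (n + 1)).IsCongruent M := by
  have hB := LinearMap.BilinForm.nondegenerate_toBilin'_of_det_ne_zero' M hd
  by_cases hne : ∃ y, M.toBilin' y y ≠ 0
  · obtain ⟨v, hv⟩ := LinearMap.BilinForm.exists_gram_eq_one hF n (isSymm_toBilin' hs) hB
      (by simp) hne
    rw [matD_one] at hv
    exact Or.inl (isCongruent_of_gram (by simp) hv)
  · push Not at hne
    obtain ⟨hev, v, hv⟩ := LinearMap.BilinForm.exists_gram_eq_matE (n + 1) (isSymm_toBilin' hs) hB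
      hne (by simp)
    exact Or.inr ⟨hev, isCongruent_of_gram (det_matE_ne_zero hev) hv⟩

end Matrix

/-! ### The counting formulas. -/

theorem mainTheorem4 {F : Type*} [Field F] [Fintype F] (n : ℕ) (hn : 1 ≤ n)
    (G : SimpleGraph (Fin (n + 1))) (hG : G.IsApex (Fin.last n)) :
    (Odd (Fintype.card F) → ∀ α : F, ¬ IsSquare α →
      (G.treeCount F : ℚ) =
        (orthBasisCount G (1 : Matrix (Fin n) (Fin n) F) : ℚ)
            / (Nat.card (omegaGroup (1 : Matrix (Fin n) (Fin n) F)) : ℚ)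
          + (orthBasisCount G (matD n α) : ℚ) / (Nat.card (omegaGroup (matD n α)) : ℚ)) ∧
    (Even (Fintype.card F) → Even n →
      (G.treeCount F : ℚ) =
        (orthBasisCount G (1 : Matrix (Fin n) (Fin n) F) : ℚ)
            / (Nat.card (omegaGroup (1 : Matrix (Fin n) (Fin n) F)) : ℚ)
          + (orthBasisCount G (matE F n) : ℚ) / (Nat.card (omegaGroup (matE F n)) : ℚ)) ∧
    (Even (Fintype.card F) → Odd n →
      (G.treeCount F : ℚ) =
        (orthBasisCount G (1 : Matrix (Fin n) (Fin n) F) : ℚ)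
            / (Nat.card (omegaGroup (1 : Matrix (Fin n) (Fin n) F)) : ℚ)) := by
  obtain ⟨m, rfl⟩ := Nat.exists_eq_add_of_le' hn
  refine ⟨fun hF α hα => ?_, fun hF hev => ?_, fun hF hodd => ?_⟩
  · exact hG.treeCount_eq_add (Matrix.isSymm_and_det_ne_zero_iff_of_odd hF hα)
      fun M hM => hM.not_matD hα
  all_goals
    have hchar : ringChar F = 2 := FiniteField.even_card_iff_char_two.mpr (Nat.even_iff.mp hF)
    have : CharP F 2 := ringChar.of_eq hchar
    have hsq : ∀ a : F, IsSquare a := FiniteField.isSquare_of_char_two hchar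
    have hone : ∀ {M : Matrix (Fin (m + 1)) (Fin (m + 1)) F},
        (1 : Matrix (Fin (m + 1)) (Fin (m + 1)) F).IsCongruent M → M.IsSymm ∧ M.det ≠ 0 :=
      fun h => ⟨h.isSymm Matrix.isSymm_one, h.det_ne_zero (by simp)⟩
  · refine hG.treeCount_eq_add (fun M => ⟨fun ⟨hs, hd⟩ => ?_, ?_⟩) fun M h h' => ?_
    · exact (Matrix.isCongruent_one_or_matE_of_charTwo hsq hs hd).imp_right And.right
    · rintro (h | h)
      · exact hone h
      · exact ⟨h.isSymm Matrix.isSymm_matE, h.det_ne_zero (Matrix.det_matE_ne_zero hev)⟩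
    -- Otherwise `E` would be congruent to `I`, whose diagonal entries are nonzero.
    · simpa using (h'.trans h.symm).diag_eq_zero 0
  · refine hG.treeCount_eq_of_forall fun M => ⟨fun ⟨hs, hd⟩ => ?_, hone⟩
    refine (Matrix.isCongruent_one_or_matE_of_charTwo hsq hs hd).resolve_right fun h => ?_
    exact Nat.not_even_iff_odd.mpr hodd h.1
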